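/- For $n\ge 1$ let $B_n$ be the braid group on $n$ strands, with Artin generators $\sigma_1,\dots,\sigma_{n-1}$, and regard $B_{n}$ as mapped to $B_{n+1}$ by $\sigma_i\mapsto\sigma_i$. Write $\beta\succ 1$ if, for some $i$, $\beta$ is represented by a word in the $\sigma_j^{\pm1}$ that contains $\sigma_i$ but neither $\sigma_i^{-1}$ nor any $\sigma_j^{\pm1}$ with $j<i$; Dehornoy's left-invariant linear order on $B_n$ is given by $\alpha\prec\beta$ iff $\alpha^{-1}\beta\succ1$. Let $\Delta=(\sigma_1\cdots\sigma_{n-1})(\sigma_1\cdots\sigma_{n-2})\cdots(\sigma_1\sigma_2)(\sigma_1)$. For $n\ge 2$ the Dehornoy floor $[\beta]_D$ is the greatest integer $m$ with $\Delta^{2m}\preceq\beta$ (so $\Delta^{2m}\preceq\beta\prec\Delta^{2m+2}$), and the fractional Dehn twist coefficient of $\beta\in B_n$ is $$BT(\beta)=\lim_{k\to\infty}\frac{[\beta^k]_D}{k}.$$ **Proposition.** Let $n\ge2$ and $\beta\in B_n$. 1. If the closed braid $\hat\beta$ admits a positive braid destabilization, that is, if $\beta$ is conjugate in $B_n$ to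 $\alpha\sigma_{n-1}$ for some $\alpha\in B_{n-1}$, then the floors and the limit that define $BT(\beta)$ exist and $0\le BT(\beta)\le 1$. 2. If $\hat\beta$ admits a negative braid destabilization, that is, if $\beta$ is conjugate in $B_n$ to $\alpha\sigma_{n-1}^{-1}$ for some $\alpha\in B_{n-1}$, then the floors and the limit that define $BT(\beta)$ exist and $-1\le BT(\beta)\le 0$. -/

import Mathlib

open Filter Topology

/-- Artin's relators on the free group on `σ₁, …, σₙ₋₁` (the index `i : Fin (n - 1)` stands for
`σᵢ₊₁`): far commutativity, and the braid relation for neighbours. -/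
def braidRels (n : ℕ) : Set (FreeGroup (Fin (n - 1))) :=
  {r | ∃ i j : Fin (n - 1), (i : ℕ) + 2 ≤ j ∧
      r = (FreeGroup.of i * FreeGroup.of j) * (FreeGroup.of j * FreeGroup.of i)⁻¹} ∪
  {r | ∃ i j : Fin (n - 1), (i : ℕ) + 1 = j ∧
      r = (FreeGroup.of i * FreeGroup.of j * FreeGroup.of i) *
        (FreeGroup.of j * FreeGroup.of i * FreeGroup.of j)⁻¹}

/-- The braid group on `n` strands. -/
abbrev Braid (n : ℕ) : Type := PresentedGroup (braidRels n)

namespace Braid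

/-- The Artin generator `σᵢ₊₁`. -/
def σ {n : ℕ} (i : Fin (n - 1)) : Braid n := PresentedGroup.of i

theorem σ_comm {n : ℕ} {i j : Fin (n - 1)} (h : (i : ℕ) + 2 ≤ j) :
    (σ i : Braid n) * σ j = σ j * σ i := by
  have hr : (FreeGroup.of i * FreeGroup.of j) * (FreeGroup.of j * FreeGroup.of i)⁻¹ ∈
      braidRels n := Or.inl ⟨i, j, h, rfl⟩
  have := PresentedGroup.one_of_mem hr
  rw [map_mul, map_inv, mul_inv_eq_one, map_mul, map_mul] at this
  exact this

theorem σ_braid {n : ℕ} {i j : Fin (n - 1)} (h : (i : ℕ) + 1 = j) :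
    (σ i : Braid n) * σ j * σ i = σ j * σ i * σ j := by
  have hr : (FreeGroup.of i * FreeGroup.of j * FreeGroup.of i) *
      (FreeGroup.of j * FreeGroup.of i * FreeGroup.of j)⁻¹ ∈ braidRels n :=
    Or.inr ⟨i, j, h, rfl⟩
  have := PresentedGroup.one_of_mem hr
  rw [map_mul, map_inv, mul_inv_eq_one, map_mul, map_mul, map_mul, map_mul] at this
  exact this

/-- The standard inclusion `Bₙ → Bₙ₊₁`, `σᵢ ↦ σᵢ` (adding one strand on the right). -/
def incl (n : ℕ) : Braid n →* Braid (n + 1) :=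
  PresentedGroup.toGroup
    (f := fun i : Fin (n - 1) =>
      (σ (Fin.castLE (Nat.sub_le_sub_right n.le_succ 1) i) : Braid (n + 1)))
    (by
      rintro r (⟨i, j, h, rfl⟩ | ⟨i, j, h, rfl⟩)
      · rw [map_mul, map_inv, mul_inv_eq_one]
        simp only [map_mul, FreeGroup.lift_apply_of]
        exact σ_comm (by simpa using h)
      · rw [map_mul, map_inv, mul_inv_eq_one]
        simp only [map_mul, FreeGroup.lift_apply_of]
        exact σ_braid (by simpa using h))

/-- The Garside braid `Δₙ = (σ₁⋯σₙ₋₁)(σ₁⋯σₙ₋₂)⋯(σ₁σ₂)(σ₁)`, that is,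
`Δₙ₊₁ = (σ₁⋯σₙ) Δₙ`. -/
def garside : (n : ℕ) → Braid n
  | 0 => 1
  | n + 1 => ((List.finRange n).map fun i => (σ i : Braid (n + 1))).prod * incl n (garside n)

/-- The braid represented by a word; the letter `(i, true)` is `σᵢ₊₁`, and `(i, false)` is its
inverse. -/
def ofWord {n : ℕ} (L : List (Fin (n - 1) × Bool)) : Braid n :=
  (L.map fun p => if p.2 then σ p.1 else (σ p.1)⁻¹).prod

/-- The word `L` contains the `i`-th generator, does not contain its inverse, and contains no
generator of smaller index, with either sign. -/
def IsSigmaPositiveWord {n : ℕ} (i : Fin (n - 1)) (L : List (Fin (n - 1) × Bool)) : Prop :=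
  (i, true) ∈ L ∧ (i, false) ∉ L ∧ ∀ p ∈ L, i ≤ p.1

/-- Dehornoy's `β ≻ 1`: for some `i`, the braid `β` has a `σᵢ`-positive word. -/
def DehornoyPos {n : ℕ} (β : Braid n) : Prop :=
  ∃ (i : Fin (n - 1)) (L : List (Fin (n - 1) × Bool)), IsSigmaPositiveWord i L ∧ ofWord L = β

/-- Dehornoy's (left-invariant) order: `α ≺ β` iff `α⁻¹ β ≻ 1`. -/
def DehornoyLT {n : ℕ} (α β : Braid n) : Prop := DehornoyPos (α⁻¹ * β)

/-- `α ≼ β`. -/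
def DehornoyLE {n : ℕ} (α β : Braid n) : Prop := α = β ∨ DehornoyLT α β

/-- `m` is the Dehornoy floor of `β`: the greatest integer `m` such that `Δ^(2m) ≼ β`
(equivalently, as the order is linear, `Δ^(2m) ≼ β ≺ Δ^(2m+2)`). -/
def IsDehornoyFloor {n : ℕ} (β : Braid n) (m : ℤ) : Prop :=
  IsGreatest {l : ℤ | DehornoyLE (garside n ^ (2 * l)) β} m

/-- `r` is the fractional Dehn twist coefficient of `β`: all powers of `β` have Dehornoy floors,
and `[β ^ k]_D / k` converges to `r`. -/
def IsBT {n : ℕ} (β : Braid n) (r : ℝ) : Prop :=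
  ∃ f : ℕ → ℤ, (∀ k, IsDehornoyFloor (β ^ k) (f k)) ∧
    Tendsto (fun k : ℕ => (f k : ℝ) / (k : ℝ)) atTop (𝓝 r)

open Classical in
/-- The fractional Dehn twist coefficient `BT(β) = lim [β ^ k]_D / k` of the braid `β`. -/
noncomputable def BT {n : ℕ} (β : Braid n) : ℝ :=
  if h : ∃ r, IsBT β r then h.choose else 0

/-- The positive stabilization `α σₘ ∈ Bₘ₊₁` of `α ∈ Bₘ`, where `m = n + 1`. -/
def posStab {n : ℕ} (α : Braid (n + 1)) : Braid (n + 2) :=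
  incl (n + 1) α * σ (Fin.last n)

/-- The negative stabilization `α σₘ⁻¹ ∈ Bₘ₊₁` of `α ∈ Bₘ`, where `m = n + 1`. -/
def negStab {n : ℕ} (α : Braid (n + 1)) : Braid (n + 2) :=
  incl (n + 1) α * (σ (Fin.last n))⁻¹

/-- The closed braid of `β` admits a positive destabilization. Closed braids are isotopic as closed
braids exactly when the braids are conjugate, so this says that `β` is conjugate to a positive
stabilization. -/
def AdmitsPosDestab {n : ℕ} (β : Braid (n + 2)) : Prop :=
  ∃ α : Braid (n + 1), IsConj (posStab α) β

/-- The closed braid of `β` admits a negative destabilization: `β` is conjugate to a negative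
stabilization. -/
def AdmitsNegDestab {n : ℕ} (β : Braid (n + 2)) : Prop :=
  ∃ α : Braid (n + 1), IsConj (negStab α) β

end Braid

/-! Conjugation by `garside` reverses the Artin generators, so it carries `α σₙ₋₁^{±1}` to `ξ
σ₁^{±1}`, where `ξ` is a word without `σ₁^{±1}` (`isShifted_conj_incl`). Then `ξ σ₁` is visibly
`σ₁`-positive. The full twist `Δ²` is central, and `Δ² σ₁⁻¹` has a positive word containing every
generator, so `Δ² (ξ σ₁)⁻¹ = (Δ² σ₁⁻¹) ξ⁻¹` is `σ₁`-positive too. Thus `1 ≼ ξ σ₁`, and `Δ²` bounds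
it above; the negative case is similar, with bounds `Δ⁻²` and `1`.

Such bounds pass to `BT`. As `Δ²` is central, a bound on a braid gives a bound on its `k`-th power,
and conjugation shifts that bound by a constant independent of `k`, which disappears on division by
`k` (`neg_le_of_isConj`, `le_of_isConj`). Floors are superadditive along powers, so Fekete's lemma
gives the limit (`exists_tendsto`).

Linearity of the order is never needed. It suffices that the positive braids form a semigroup, that
`Δ²` is central and cofinal, and that `1` is not positive. The last point, acyclicity, comes from an
action of the braid group on sequences of pairs of positive rationals: `σᵢ` strictly increases the
first coordinate of label `i`, and generators of larger index leave that label alone. -/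

namespace Braid

/-! ### Dynnikov's map and the Yang–Baxter equation. -/

/-- Pairs of positive rationals, the labels of a strand in `labelAct`. -/
abbrev Label : Type := {p : ℚ × ℚ // 0 < p.1 ∧ 0 < p.2}

/-- The subtraction-free form of Dynnikov's action of a braid generator on a pair of labels. -/
def dynnikov (a b : Label) : Label × Label :=
  let x := a.1.1
  let y := a.1.2
  let z := b.1.1
  let w := b.1.2
  have hx : 0 < x := a.2.1
  have hy : 0 < y := a.2.2
  have hz : 0 < z := b.2.1
  have hw : 0 < w := b.2.2
  (⟨(x + y * (x + z), z * y * w / (y * z + x * (1 + y) * (1 + w))), by positivity, by positivity⟩,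
    ⟨(x * z * w / (x + z + x * w), (y * z + x * (1 + y) * (1 + w)) / z),
      by positivity, by positivity⟩)

/-- The inverse of `dynnikov`. -/
def dynnikovInv (a b : Label) : Label × Label :=
  let x := a.1.1
  let y := a.1.2
  let z := b.1.1
  let w := b.1.2
  have hx : 0 < x := a.2.1
  have hy : 0 < y := a.2.2
  have hz : 0 < z := b.2.1
  have hw : 0 < w := b.2.2
  (⟨(x * z / ((1 + y) * z + x * y), w * x * y / (x * y + (1 + y) * z * (1 + w))),
      by positivity, by positivity⟩,
    ⟨((x + z + z * w) / w, (x * y + (1 + y) * z * (1 + w)) / x), by positivity, by positivity⟩)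

theorem dynnikovInv_dynnikov (a b : Label) :
    dynnikovInv (dynnikov a b).1 (dynnikov a b).2 = (a, b) := by
  obtain ⟨⟨x, y⟩, hx, hy⟩ := a
  obtain ⟨⟨z, w⟩, hz, hw⟩ := b
  simp only at hx hy hz hw
  ext <;> simp only [dynnikov, dynnikovInv] <;> field_simp <;> ring

theorem dynnikov_dynnikovInv (a b : Label) :
    dynnikov (dynnikovInv a b).1 (dynnikovInv a b).2 = (a, b) := by
  obtain ⟨⟨x, y⟩, hx, hy⟩ := a
  obtain ⟨⟨z, w⟩, hz, hw⟩ := b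
  simp only at hx hy hz hw
  ext <;> simp only [dynnikov, dynnikovInv] <;> field_simp <;> ring

/-- The increment `y * (x + z)` is positive because all labels are. This inequality is the source of
acyclicity. -/
theorem lt_dynnikov (a b : Label) : a.1.1 < (dynnikov a b).1.1.1 := by
  obtain ⟨⟨x, y⟩, hx, hy⟩ := a
  obtain ⟨⟨z, w⟩, hz, hw⟩ := b
  simp only at hx hy hz hw
  simp only [dynnikov]
  have : 0 < y * (x + z) := by positivity
  linarith

/-- With the denominators of `dynnikov` cleared, a value can be certified by four identities, whose
sides can be simplified separately. -/
theorem dynnikov_eq {x y z w x' y' z' w' : ℚ} (h : 0 < x ∧ 0 < y) (k : 0 < z ∧ 0 < w)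
    (h' : 0 < x' ∧ 0 < y') (k' : 0 < z' ∧ 0 < w')
    (e₁ : x + y * (x + z) = x')
    (e₂ : z * y * w = y' * (y * z + x * (1 + y) * (1 + w)))
    (e₃ : x * z * w = z' * (x + z + x * w))
    (e₄ : y * z + x * (1 + y) * (1 + w) = w' * z) :
    dynnikov ⟨(x, y), h⟩ ⟨(z, w), k⟩ = (⟨(x', y'), h'⟩, ⟨(z', w'), k'⟩) := by
  obtain ⟨hx, hy⟩ := h
  obtain ⟨hz, hw⟩ := k
  have hq : 0 < y * z + x * (1 + y) * (1 + w) := by positivity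
  have hs : 0 < x + z + x * w := by positivity
  ext <;> dsimp only [dynnikov]
  · exact e₁
  · rw [e₂]; field_simp
  · rw [e₃]; field_simp
  · rw [e₄]; field_simp

/-- The Yang–Baxter equation for `dynnikov`, acting on three labels `a, b, c`. -/
theorem dynnikov_yangBaxter (a b c : Label) :
    let p := dynnikov a b
    let q := dynnikov p.2 c
    let r := dynnikov p.1 q.1
    let p' := dynnikov b c
    let q' := dynnikov a p'.1
    let r' := dynnikov q'.2 p'.2
    r.1 = q'.1 ∧ r.2 = r'.1 ∧ q.2 = r'.2 := by
  obtain ⟨⟨x, y⟩, hx, hy⟩ := a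
  obtain ⟨⟨z, w⟩, hz, hw⟩ := b
  obtain ⟨⟨u, v⟩, hu, hv⟩ := c
  simp only at hx hy hz hw hu hv
  -- These polynomials are the factors from which every intermediate label is built. Kept opaque and
  -- positive, they let `field_simp` cancel them without expanding.
  obtain ⟨n, hn⟩ : ∃ n, n = x * w * (1 + y) := ⟨_, rfl⟩
  obtain ⟨A, hA⟩ : ∃ A, A = x + y * (x + z) := ⟨_, rfl⟩
  obtain ⟨q, hq⟩ : ∃ q, q = A + n := ⟨_, rfl⟩
  obtain ⟨s, hs⟩ : ∃ s, s = x + z + x * w := ⟨_, rfl⟩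
  obtain ⟨E, hE⟩ : ∃ E, E = z * n + u * q := ⟨_, rfl⟩
  obtain ⟨T, hT⟩ : ∃ T, T = u * q + z * n * (1 + v) := ⟨_, rfl⟩
  obtain ⟨M, hM⟩ : ∃ M, M = z + w * (z + u) := ⟨_, rfl⟩
  obtain ⟨k, hk⟩ : ∃ k, k = z + u + z * v := ⟨_, rfl⟩
  obtain ⟨t, ht⟩ : ∃ t, t = w * k + z * (1 + v) := ⟨_, rfl⟩
  obtain ⟨G, hG⟩ : ∃ G, G = y * t + x * (1 + y) * (1 + v) := ⟨_, rfl⟩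
  obtain ⟨J, hJ⟩ : ∃ J, J = x * (1 + v) + t := ⟨_, rfl⟩
  obtain ⟨U, hU⟩ : ∃ U, U = x * z * w * (1 + v) + u * s := ⟨_, rfl⟩
  have pn : 0 < n := hn ▸ by positivity
  have pA : 0 < A := hA ▸ by positivity
  have pq : 0 < q := hq ▸ by positivity
  have ps : 0 < s := hs ▸ by positivity
  have pE : 0 < E := hE ▸ by positivity
  have pT : 0 < T := hT ▸ by positivity
  have pM : 0 < M := hM ▸ by positivity
  have pk : 0 < k := hk ▸ by positivity
  have pt : 0 < t := ht ▸ by positivity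
  have pG : 0 < G := hG ▸ by positivity
  have pJ : 0 < J := hJ ▸ by positivity
  have pU : 0 < U := hU ▸ by positivity
  -- The factorizations behind the cancellations: each compound expression met below becomes a
  -- product of the named factors.
  have i₁ : y * z + x * (1 + y) * (1 + w) = q := by subst hq hn hA; ring
  have i₂ : z + q = (1 + y) * s := by subst hq hn hA hs; ring
  have i₃ : T + u * q * v = (1 + v) * E := by subst hT hE; ring
  have i₄ : y * w * T + A * (q + z * y * w) * (1 + v) = G * q := by
    subst hT hG ht hk hq hn hA; ring
  have i₅ : t + u * w * v = (1 + v) * M := by subst ht hk hM; ring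
  have i₆ : t + G = (1 + y) * J := by subst hG hJ; ring
  have i₇ : n * k + G * z = t * A := by subst hn hG hA ht; ring
  have i₈ : u * A + n * k = T := by subst hT hq hk; ring
  have i₉ : x * u * w * k + z * u * J + x * w * t * k = t * U := by
    subst hU hs hJ ht hk; ring
  -- `d₁`, `d₂`, `d₃` evaluate one side of the equation and `d₄`, `d₅`, `d₆` the other; the final
  -- labels have the same closed forms.
  have d₁ : dynnikov ⟨(x, y), hx, hy⟩ ⟨(z, w), hz, hw⟩ =
      (⟨(A, z * y * w / q), by positivity, by positivity⟩,
        ⟨(x * z * w / s, q / z), by positivity, by positivity⟩) := by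
    apply dynnikov_eq
    · exact hA.symm
    · rw [i₁]; field_simp
    · rw [← hs]; field_simp
    · rw [i₁]; field_simp
  have d₂ : dynnikov ⟨(x * z * w / s, q / z), by positivity, by positivity⟩ ⟨(u, v), hu, hv⟩ =
      (⟨(E / z, u * q * v / T), by positivity, by positivity⟩,
        ⟨(x * z * w * u * v / U, T / (z * u)), by positivity, by positivity⟩) := by
    have hc : 1 + q / z = (1 + y) * s / z := by rw [← i₂]; field_simp
    have hd : q / z * u + x * z * w / s * (1 + q / z) * (1 + v) = T / z := by
      rw [hc, hT, hn]; field_simp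
    apply dynnikov_eq
    · calc _ = x * z * w / s * (1 + q / z) + q / z * u := by ring
        _ = _ := by rw [hc, hE, hn]; field_simp
    · rw [hd]; field_simp
    · have : x * z * w / s + u + x * z * w / s * v = U / s := by
        rw [hU]; field_simp; ring
      rw [this]; field_simp
    · rw [hd]; field_simp
  have d₃ : dynnikov ⟨(A, z * y * w / q), by positivity, by positivity⟩
      ⟨(E / z, u * q * v / T), by positivity, by positivity⟩ =
      (⟨(A + y * w * (z + u), y * u * w * v / G), by positivity, by positivity⟩,
        ⟨(u * v * A / k, z * G / T), by positivity, by positivity⟩) := by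
    have hd : z * y * w / q * (E / z) + A * (1 + z * y * w / q) * (1 + u * q * v / T) =
        E * G / T := by
      have h₁ : 1 + u * q * v / T = (1 + v) * E / T := by rw [← i₃]; field_simp
      rw [h₁]; field_simp; linear_combination i₄
    apply dynnikov_eq
    · field_simp; subst hE hq; ring
    · rw [hd]; field_simp
    · have h₁ : A + E / z + A * (u * q * v / T) = E * q * k / (z * T) := by
        have h₂ : A + E / z + A * (u * q * v / T) = A * (T + u * q * v) / T + E / z := by
          field_simp; ring
        rw [h₂, i₃]; field_simp; subst hT hq hk; ring
      rw [h₁]; field_simp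
    · rw [hd]; field_simp
  have d₄ : dynnikov ⟨(z, w), hz, hw⟩ ⟨(u, v), hu, hv⟩ =
      (⟨(M, u * w * v / t), by positivity, by positivity⟩,
        ⟨(z * u * v / k, t / u), by positivity, by positivity⟩) := by
    have hd : w * u + z * (1 + w) * (1 + v) = t := by subst ht hk; ring
    apply dynnikov_eq
    · exact hM.symm
    · rw [hd]; field_simp
    · rw [← hk]; field_simp
    · rw [hd]; field_simp
  have d₅ : dynnikov ⟨(x, y), hx, hy⟩ ⟨(M, u * w * v / t), by positivity, by positivity⟩ =
      (⟨(A + y * w * (z + u), y * u * w * v / G), by positivity, by positivity⟩,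
        ⟨(x * u * w * v / J, G / t), by positivity, by positivity⟩) := by
    have hc : 1 + u * w * v / t = (1 + v) * M / t := by rw [← i₅]; field_simp
    have hd : y * M + x * (1 + y) * (1 + u * w * v / t) = M * G / t := by
      rw [hc, hG]; field_simp
    apply dynnikov_eq
    · subst hA hM; ring
    · rw [hd]; field_simp
    · have : x + M + x * (u * w * v / t) = M * J / t := by
        calc _ = x * (1 + u * w * v / t) + M := by ring
          _ = _ := by rw [hc, hJ]; field_simp
      rw [this]; field_simp
    · rw [hd]; field_simp
  have d₆ : dynnikov ⟨(x * u * w * v / J, G / t), by positivity, by positivity⟩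
      ⟨(z * u * v / k, t / u), by positivity, by positivity⟩ =
      (⟨(u * v * A / k, z * G / T), by positivity, by positivity⟩,
        ⟨(x * z * w * u * v / U, T / (z * u)), by positivity, by positivity⟩) := by
    have hc : 1 + G / t = (1 + y) * J / t := by rw [← i₆]; field_simp
    have he : G / t * (z * u * v / k) + x * u * w * v / J * (1 + G / t) = u * v * A / k := by
      rw [hc]; field_simp; rw [hn] at i₇; linear_combination i₇
    have hd : G / t * (z * u * v / k) + x * u * w * v / J * (1 + G / t) * (1 + t / u) =
        v * T / k := by
      calc _ = G / t * (z * u * v / k) + x * u * w * v / J * (1 + G / t) +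
            x * u * w * v / J * (1 + G / t) * (t / u) := by ring
        _ = _ := by
          rw [he, hc]; field_simp; rw [hn] at i₈; linear_combination i₈
    apply dynnikov_eq
    · rw [← he]; ring
    · rw [hd]; field_simp
    · have : x * u * w * v / J + z * u * v / k + x * u * w * v / J * (t / u) =
          v * t * U / (J * k) := by
        field_simp; linear_combination i₉
      rw [this]; field_simp
    · rw [hd]; field_simp
  simp only [d₁, d₂, d₃, d₄, d₅, d₆, and_self]
end Braid

/-! ### Garside elements of sequences satisfying the braid relations. -/

/-- A sequence in a group whose first `M` terms satisfy Artin's braid relations. -/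
structure IsBraidSeq {G : Type*} [Group G] (s : ℕ → G) (M : ℕ) : Prop where
  comm : ∀ {i j : ℕ}, i + 2 ≤ j → s i * s j = s j * s i
  braid : ∀ {i : ℕ}, i + 1 < M → s i * s (i + 1) * s i = s (i + 1) * s i * s (i + 1)

namespace IsBraidSeq

variable {G : Type*} [Group G]

/-- `s 0 * s 1 * ⋯ * s (n - 1)`. -/
def asc (s : ℕ → G) : ℕ → G
  | 0 => 1
  | n + 1 => asc s n * s n

/-- `s (n - 1) * ⋯ * s 1 * s 0`. -/
def desc (s : ℕ → G) : ℕ → G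
  | 0 => 1
  | n + 1 => s n * desc s n

/-- The Garside element of the first `n - 1` terms of `s`. -/
def delta (s : ℕ → G) : ℕ → G
  | 0 => 1
  | n + 1 => asc s n * delta s n

theorem asc_eq_prod (s : ℕ → G) (n : ℕ) : asc s n = ((List.range n).map s).prod := by
  induction n with
  | zero => rfl
  | succ n ih => simp [List.range_succ, asc, ih]

variable {s : ℕ → G} {M : ℕ}

theorem asc_comm (h : IsBraidSeq s M) {n j : ℕ} (hj : n + 1 ≤ j) :
    asc s n * s j = s j * asc s n := by
  induction n with
  | zero => simp [asc]
  | succ n ih =>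
    rw [asc, mul_assoc, h.comm (by omega), ← mul_assoc, ih (by omega), mul_assoc]

theorem desc_comm (h : IsBraidSeq s M) {n j : ℕ} (hj : n + 1 ≤ j) :
    desc s n * s j = s j * desc s n := by
  induction n with
  | zero => simp [desc]
  | succ n ih =>
    rw [desc, mul_assoc, ih (by omega), ← mul_assoc, h.comm (by omega), mul_assoc]

theorem delta_comm (h : IsBraidSeq s M) {n j : ℕ} (hj : n ≤ j) :
    delta s n * s j = s j * delta s n := by
  induction n with
  | zero => simp [delta]
  | succ n ih =>
    rw [delta, mul_assoc, ih (by omega), ← mul_assoc, h.asc_comm hj, mul_assoc]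

/-- Passing through `asc` raises an index by one; passing through `desc` lowers it. Together they
produce the reversal by `delta`. -/
theorem asc_mul (h : IsBraidSeq s M) {n i : ℕ} (hi : i + 1 < n) (hn : n ≤ M) :
    asc s n * s i = s (i + 1) * asc s n := by
  induction n with
  | zero => omega
  | succ n ih =>
    rcases Nat.lt_or_ge (i + 1) n with hlt | hge
    · rw [asc, mul_assoc, ← h.comm (by omega), ← mul_assoc, ih hlt (by omega), mul_assoc]
    · obtain rfl : n = i + 1 := by omega
      rw [asc, asc, mul_assoc, mul_assoc, ← mul_assoc (s i), h.braid (by omega),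
        ← mul_assoc, ← mul_assoc, h.asc_comm le_rfl]
      simp only [mul_assoc]

theorem desc_mul (h : IsBraidSeq s M) {n i : ℕ} (hi : i + 1 < n) (hn : n ≤ M) :
    desc s n * s (i + 1) = s i * desc s n := by
  induction n with
  | zero => omega
  | succ n ih =>
    rcases Nat.lt_or_ge (i + 1) n with hlt | hge
    · rw [desc, mul_assoc, ih hlt (by omega), ← mul_assoc, ← h.comm (by omega), mul_assoc]
    · obtain rfl : n = i + 1 := by omega
      rw [desc, desc, mul_assoc, mul_assoc, h.desc_comm le_rfl, ← mul_assoc, ← mul_assoc,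
        ← h.braid (by omega)]
      simp only [mul_assoc]

/-- A second factorization of `delta`, with the new factor on the right. It handles the top
generator, which the induction hypothesis for `delta_mul` does not cover. -/
theorem delta_succ' (h : IsBraidSeq s M) (n : ℕ) : delta s (n + 1) = delta s n * desc s n := by
  induction n with
  | zero => simp [delta, desc, asc]
  | succ n ih =>
    rw [delta, ih, asc, desc, ← mul_assoc, mul_assoc (asc s n), ← h.delta_comm le_rfl,
      ← mul_assoc, ← delta, ih, mul_assoc]

/-- Conjugation by the Garside element reverses the order of the generators. -/
theorem delta_mul (h : IsBraidSeq s M) {n i : ℕ} (hi : i < n) (hn : n ≤ M) :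
    delta s (n + 1) * s i = s (n - 1 - i) * delta s (n + 1) := by
  induction n generalizing i with
  | zero => omega
  | succ n ih =>
    rcases Nat.lt_or_ge i n with hlt | hge
    · rw [delta, mul_assoc, ih hlt (by omega), ← mul_assoc, h.asc_mul (by omega) hn, mul_assoc]
      congr 2
      omega
    · obtain rfl : n = i := by omega
      rcases n with _ | n
      · simp [delta, asc]
      -- The top generator is first lowered by `desc`, which brings it within reach of `ih`.
      · rw [h.delta_succ', mul_assoc, h.desc_mul (by omega) hn, ← mul_assoc,
          ih (by omega) (by omega), mul_assoc]
        congr 2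
        omega

end IsBraidSeq

/-! ### Floors with respect to a central cofinal element. -/

/-- A submonoid `P` of "non-negative" elements of a group, and a central cofinal element `z`
none of whose negative powers lies in `P`. -/
structure CentralCone {G : Type*} [Group G] (P : Submonoid G) (z : G) : Prop where
  comm : ∀ g : G, Commute z g
  nonneg_of_mem : ∀ l : ℤ, z ^ l ∈ P → 0 ≤ l
  cofinal : ∀ g : G, ∃ c : ℤ, z ^ c * g ∈ P

namespace CentralCone

variable {G : Type*} [Group G] {P : Submonoid G} {z : G}

theorem zpow_comm (h : CentralCone P z) (l : ℤ) (g : G) : z ^ l * g = g * z ^ l :=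
  ((h.comm g).zpow_left l).eq

theorem mul_mem (h : CentralCone P z) {a b : ℤ} {x y : G} (hx : z ^ a * x ∈ P)
    (hy : z ^ b * y ∈ P) : z ^ (a + b) * (x * y) ∈ P := by
  have := P.mul_mem hx hy
  rwa [mul_assoc, ← mul_assoc x, ← h.zpow_comm b x, mul_assoc, ← mul_assoc, ← zpow_add] at this

theorem pow_mem (h : CentralCone P z) {a : ℤ} {x : G} (hx : z ^ a * x ∈ P) (k : ℕ) :
    z ^ (a * k) * x ^ k ∈ P := by
  have := P.pow_mem hx k
  rwa [((h.comm x).zpow_left a).mul_pow, ← zpow_natCast, ← zpow_mul] at this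

/-- Bounding `g` and `g⁻¹` below by powers of `z` costs a constant depending on `g` alone.
Uniformity in `a` and `x` is what allows it to be applied to all powers of an element. -/
theorem exists_conj_mem (h : CentralCone P z) (g : G) :
    ∃ c : ℤ, ∀ (a : ℤ) (x : G), z ^ a * x ∈ P → z ^ (a + c) * (g * x * g⁻¹) ∈ P := by
  obtain ⟨c, hc⟩ := h.cofinal g
  obtain ⟨d, hd⟩ := h.cofinal g⁻¹
  refine ⟨c + d, fun a x hx => ?_⟩
  have := h.mul_mem (h.mul_mem hc hx) hd
  rwa [show c + a + d = a + (c + d) by ring] at this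

/-- `m` is the greatest integer with `z ^ m ≤ g`. -/
def IsFloor (P : Submonoid G) (z g : G) (m : ℤ) : Prop :=
  IsGreatest {l : ℤ | z ^ (-l) * g ∈ P} m

theorem le_of_mem (h : CentralCone P z) {g : G} {a l : ℤ} (ha : z ^ a * g⁻¹ ∈ P)
    (hl : z ^ (-l) * g ∈ P) : l ≤ a := by
  have := h.mul_mem ha hl
  rw [inv_mul_cancel, mul_one] at this
  have := h.nonneg_of_mem _ this
  omega

theorem exists_isFloor (h : CentralCone P z) (g : G) : ∃ m, IsFloor P z g m := by
  obtain ⟨c, hc⟩ := h.cofinal g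
  obtain ⟨d, hd⟩ := h.cofinal g⁻¹
  obtain ⟨m, hm, hmax⟩ := Int.exists_greatest_of_bdd (P := fun l => z ^ (-l) * g ∈ P)
    ⟨d, fun l hl => h.le_of_mem hd hl⟩ ⟨-c, by simpa using hc⟩
  exact ⟨m, hm, fun l hl => hmax l hl⟩

/-- The floors of the powers of `g` grow linearly. -/
theorem exists_tendsto (h : CentralCone P z) (g : G) (f : ℕ → ℤ)
    (hf : ∀ k, IsFloor P z (g ^ k) (f k)) :
    ∃ r : ℝ, Tendsto (fun k : ℕ => (f k : ℝ) / (k : ℝ)) atTop (𝓝 r) := by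
  -- Multiplying two lower bounds shows that the floors are superadditive; Fekete's lemma is applied
  -- to their negatives.
  have hsub : Subadditive fun k => -(f k : ℝ) := fun j k => by
    have hjk := (hf (j + k)).2 (show f j + f k ∈ _ by
      have := h.mul_mem (hf j).1 (hf k).1
      rw [← neg_add, ← pow_add] at this
      exact this)
    have : (f j : ℝ) + f k ≤ f (j + k) := by exact_mod_cast hjk
    linarith
  obtain ⟨c, hc⟩ := h.cofinal g⁻¹
  have hbdd : BddBelow (Set.range fun k : ℕ => -(f k : ℝ) / k) := by
    -- The absolute value also covers `k = 0`, where the quotient is `0` by convention.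
    refine ⟨-|(c : ℝ)|, ?_⟩
    rintro _ ⟨k, rfl⟩
    have hk : f k ≤ c * k := h.le_of_mem (inv_pow g k ▸ h.pow_mem hc k) (hf k).1
    rcases k.eq_zero_or_pos with rfl | hpos
    · simp
    have hpos' : (0 : ℝ) < k := by exact_mod_cast hpos
    have hk' : (f k : ℝ) ≤ c * k := by exact_mod_cast hk
    dsimp only
    rw [le_div_iff₀ hpos']
    nlinarith [le_abs_self (c : ℝ)]
  refine ⟨-hsub.lim, ?_⟩
  have := (hsub.tendsto_lim hbdd).neg
  simpa [neg_div] using this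

theorem tendsto_add_div (a c : ℝ) :
    Tendsto (fun k : ℕ => (a * k + c) / (k : ℝ)) atTop (𝓝 a) := by
  have h₁ : Tendsto (fun k : ℕ => a + c / (k : ℝ)) atTop (𝓝 (a + 0)) :=
    tendsto_const_nhds.add (tendsto_const_div_atTop_nhds_zero_nat c)
  rw [add_zero] at h₁
  refine h₁.congr' ?_
  filter_upwards [eventually_gt_atTop 0] with k hk
  have : (k : ℝ) ≠ 0 := by positivity
  field_simp

/-- From `z ^ a * x ∈ P`, the floor of the `k`-th power of a conjugate of `x` is at least `-a * k -
c`, with `c` independent of `k`. -/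
theorem neg_le_of_isConj (h : CentralCone P z) {x g : G} {a : ℤ} (hx : z ^ a * x ∈ P)
    (hc : IsConj x g) {f : ℕ → ℤ} (hf : ∀ k, IsFloor P z (g ^ k) (f k)) {r : ℝ}
    (hr : Tendsto (fun k : ℕ => (f k : ℝ) / (k : ℝ)) atTop (𝓝 r)) : -(a : ℝ) ≤ r := by
  obtain ⟨b, rfl⟩ := isConj_iff.1 hc
  obtain ⟨c, hc⟩ := h.exists_conj_mem b
  refine le_of_tendsto_of_tendsto' (tendsto_add_div (-(a : ℝ)) (-c)) hr fun k => ?_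
  have hk : -a * k + -c ≤ f k := (hf k).2 (by
    have := hc _ _ (h.pow_mem hx k)
    rw [← conj_pow] at this
    change z ^ (-(-a * k + -c)) * _ ∈ P
    rwa [show -(-a * (k : ℤ) + -c) = a * k + c by ring])
  gcongr
  exact_mod_cast hk

theorem le_of_isConj (h : CentralCone P z) {x g : G} {a : ℤ} (hx : z ^ a * x⁻¹ ∈ P)
    (hc : IsConj x g) {f : ℕ → ℤ} (hf : ∀ k, IsFloor P z (g ^ k) (f k)) {r : ℝ}
    (hr : Tendsto (fun k : ℕ => (f k : ℝ) / (k : ℝ)) atTop (𝓝 r)) : r ≤ a := by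
  obtain ⟨b, rfl⟩ := isConj_iff.1 hc
  obtain ⟨c, hc⟩ := h.exists_conj_mem b
  refine le_of_tendsto_of_tendsto' hr (tendsto_add_div (a : ℝ) c) fun k => ?_
  have hk : f k ≤ a * k + c := h.le_of_mem (by
    have := hc _ _ (h.pow_mem hx k)
    rwa [inv_pow, ← conj_inv, ← conj_pow] at this) (hf k).1
  gcongr
  exact_mod_cast hk

end CentralCone
namespace Braid

/-! ### The action on labels, acyclicity and the monoid of non-negative braids. -/

/-- The map `f` applied to the neighbouring labels `i` and `i + 1`. -/
def applyAt {X : Type*} (f : X → X → X × X) (i : ℕ) (v : ℕ → X) : ℕ → X := fun k =>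
  if k = i then (f (v i) (v (i + 1))).1
  else if k = i + 1 then (f (v i) (v (i + 1))).2 else v k

section applyAt

variable {X : Type*} {f g : X → X → X × X}

@[simp] theorem applyAt_self (i : ℕ) (v : ℕ → X) :
    applyAt f i v i = (f (v i) (v (i + 1))).1 := by simp [applyAt]

@[simp] theorem applyAt_succ (i : ℕ) (v : ℕ → X) :
    applyAt f i v (i + 1) = (f (v i) (v (i + 1))).2 := by simp [applyAt]

theorem applyAt_of_ne {i k : ℕ} (v : ℕ → X) (h₁ : k ≠ i) (h₂ : k ≠ i + 1) :
    applyAt f i v k = v k := by simp [applyAt, h₁, h₂]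

theorem applyAt_leftInverse (h : ∀ a b, g (f a b).1 (f a b).2 = (a, b)) (i : ℕ) :
    Function.LeftInverse (applyAt g i) (applyAt f i) := fun v => by
  funext k
  rcases eq_or_ne k i with rfl | h₁
  · simp [h]
  rcases eq_or_ne k (i + 1) with rfl | h₂
  · simp [h]
  simp only [applyAt_of_ne _ h₁ h₂]

theorem applyAt_comm {i j : ℕ} (h : i + 2 ≤ j) (v : ℕ → X) :
    applyAt f i (applyAt f j v) = applyAt f j (applyAt f i v) := by
  have e₁ : applyAt f j v i = v i := applyAt_of_ne v (by omega) (by omega)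
  have e₂ : applyAt f j v (i + 1) = v (i + 1) := applyAt_of_ne v (by omega) (by omega)
  have e₃ : applyAt f i v j = v j := applyAt_of_ne v (by omega) (by omega)
  have e₄ : applyAt f i v (j + 1) = v (j + 1) := applyAt_of_ne v (by omega) (by omega)
  funext k
  rcases eq_or_ne k i with rfl | h₁
  · rw [applyAt_self, e₁, e₂, applyAt_of_ne _ (by omega) (by omega), applyAt_self]
  rcases eq_or_ne k (i + 1) with rfl | h₂
  · rw [applyAt_succ, e₁, e₂, applyAt_of_ne _ (by omega) (by omega), applyAt_succ]
  rw [applyAt_of_ne _ h₁ h₂]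
  rcases eq_or_ne k j with rfl | h₃
  · rw [applyAt_self, applyAt_self, e₃, e₄]
  rcases eq_or_ne k (j + 1) with rfl | h₄
  · rw [applyAt_succ, applyAt_succ, e₃, e₄]
  rw [applyAt_of_ne _ h₃ h₄, applyAt_of_ne _ h₃ h₄, applyAt_of_ne _ h₁ h₂]

theorem applyAt_braid
    (h : ∀ a b c,
      let p := f a b
      let q := f p.2 c
      let r := f p.1 q.1
      let p' := f b c
      let q' := f a p'.1
      let r' := f q'.2 p'.2
      r.1 = q'.1 ∧ r.2 = r'.1 ∧ q.2 = r'.2) (i : ℕ) (v : ℕ → X) :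
    applyAt f i (applyAt f (i + 1) (applyAt f i v)) =
      applyAt f (i + 1) (applyAt f i (applyAt f (i + 1) v)) := by
  have n₁ : i ≠ i + 1 + 1 := by omega
  have n₂ : i + 1 + 1 ≠ i := by omega
  obtain ⟨h₁, h₂, h₃⟩ := h (v i) (v (i + 1)) (v (i + 1 + 1))
  funext k
  rcases eq_or_ne k i with rfl | k₁
  · simpa [applyAt, n₁, n₂] using h₁
  rcases eq_or_ne k (i + 1) with rfl | k₂
  · simpa [applyAt, n₁, n₂] using h₂
  rcases eq_or_ne k (i + 1 + 1) with rfl | k₃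
  · simpa [applyAt, n₁, n₂] using h₃
  simp [applyAt, k₁, k₂, k₃]

end applyAt

/-- The permutation of the sequences of labels given by the generator `σᵢ₊₁`. -/
def labelPerm (i : ℕ) : Equiv.Perm (ℕ → Label) where
  toFun := applyAt dynnikov i
  invFun := applyAt dynnikovInv i
  left_inv := applyAt_leftInverse dynnikovInv_dynnikov i
  right_inv := applyAt_leftInverse dynnikov_dynnikovInv i

/-- The action of the braid group on sequences of labels. -/
def labelAct (n : ℕ) : Braid n →* Equiv.Perm (ℕ → Label) :=
  PresentedGroup.toGroup (f := fun i : Fin (n - 1) => labelPerm i) (by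
    rintro r (⟨i, j, h, rfl⟩ | ⟨i, j, h, rfl⟩)
    · rw [map_mul, map_inv, mul_inv_eq_one]
      simp only [map_mul, FreeGroup.lift_apply_of]
      exact Equiv.ext fun v => applyAt_comm h v
    · rw [map_mul, map_inv, mul_inv_eq_one]
      simp only [map_mul, FreeGroup.lift_apply_of, ← h]
      exact Equiv.ext fun v => applyAt_braid dynnikov_yangBaxter i v)

theorem labelAct_σ {n : ℕ} (i : Fin (n - 1)) : labelAct n (σ i) = labelPerm i :=
  PresentedGroup.toGroup.of _

theorem ofWord_cons {n : ℕ} (p : Fin (n - 1) × Bool) (L : List (Fin (n - 1) × Bool)) :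
    ofWord (p :: L) = (if p.2 then σ p.1 else (σ p.1)⁻¹) * ofWord L := by
  simp [ofWord]

theorem ofWord_append {n : ℕ} (L M : List (Fin (n - 1) × Bool)) :
    ofWord (L ++ M) = ofWord L * ofWord M := by
  simp [ofWord]

/-- Induction on the word, whose first letter acts last. A letter `σᵢ` raises the first coordinate
of label `i`, while `σⱼ^{±1}` with `j > i` touches only labels `j` and `j + 1`. -/
theorem label_le_of_word {n : ℕ} {i : Fin (n - 1)} {L : List (Fin (n - 1) × Bool)}
    (h₁ : (i, false) ∉ L) (h₂ : ∀ p ∈ L, i ≤ p.1) (v : ℕ → Label) :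
    (v i).1.1 ≤ (labelAct n (ofWord L) v i).1.1 ∧
      ((i, true) ∈ L → (v i).1.1 < (labelAct n (ofWord L) v i).1.1) := by
  induction L with
  | nil => simp [ofWord]
  | cons p L ih =>
    obtain ⟨le, lt⟩ := ih (fun h => h₁ (List.mem_cons_of_mem _ h))
      (fun q hq => h₂ q (List.mem_cons_of_mem _ hq))
    obtain ⟨j, e⟩ := p
    rw [ofWord_cons, map_mul, Equiv.Perm.mul_apply]
    set w := labelAct n (ofWord L) v
    rcases eq_or_ne i j with rfl | hne
    · obtain rfl : e = true := by
        cases e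
        · exact absurd List.mem_cons_self h₁
        · rfl
      have : (w i).1.1 < (labelPerm i w i).1.1 := by
        change _ < (applyAt dynnikov i w i).1.1
        rw [applyAt_self]
        exact lt_dynnikov _ _
      simp only [if_true, labelAct_σ]
      exact ⟨(le.trans_lt this).le, fun _ => le.trans_lt this⟩
    · have hlt : (i : ℕ) < j := lt_of_le_of_ne (h₂ (j, e) List.mem_cons_self)
        (fun h => hne (Fin.ext h))
      have hfix : labelAct n (if e then σ j else (σ j)⁻¹) w i = w i := by
        cases e
        · simp only [Bool.false_eq_true, if_false, map_inv, labelAct_σ]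
          exact applyAt_of_ne (f := dynnikovInv) w (by omega) (by omega)
        · simp only [if_true, labelAct_σ]
          exact applyAt_of_ne (f := dynnikov) w (by omega) (by omega)
      dsimp only
      rw [hfix]
      refine ⟨le, fun hm => lt ?_⟩
      rcases List.mem_cons.1 hm with h | h
      · exact absurd (congrArg Prod.fst h) hne
      · exact h

/-- Dehornoy's acyclicity property: a `σᵢ`-positive word does not represent the trivial braid. -/
theorem not_dehornoyPos_one {n : ℕ} : ¬ DehornoyPos (1 : Braid n) := by
  rintro ⟨i, L, ⟨h₁, h₂, h₃⟩, hL⟩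
  -- Any starting labels would do; the constant sequence `(1, 1)` is one choice.
  have := (label_le_of_word h₂ h₃ fun _ => ⟨(1, 1), one_pos, one_pos⟩).2 h₁
  rw [hL, map_one] at this
  exact lt_irrefl _ this

/-- The concatenated word is positive for the smaller of the two indices. -/
theorem DehornoyPos.mul {n : ℕ} {α β : Braid n} (hα : DehornoyPos α) (hβ : DehornoyPos β) :
    DehornoyPos (α * β) := by
  obtain ⟨i, L, ⟨h₁, h₂, h₃⟩, rfl⟩ := hα
  obtain ⟨j, M, ⟨k₁, k₂, k₃⟩, rfl⟩ := hβ
  rcases lt_trichotomy i j with h | rfl | h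
  · refine ⟨i, L ++ M, ⟨List.mem_append_left _ h₁, ?_, ?_⟩, ofWord_append L M⟩
    · rw [List.mem_append, not_or]
      exact ⟨h₂, fun hm => absurd (k₃ _ hm) (not_le.2 h)⟩
    · intro p hp
      rcases List.mem_append.1 hp with hp | hp
      exacts [h₃ p hp, h.le.trans (k₃ p hp)]
  · refine ⟨i, L ++ M, ⟨List.mem_append_left _ h₁, ?_, ?_⟩, ofWord_append L M⟩
    · rw [List.mem_append, not_or]
      exact ⟨h₂, k₂⟩
    · intro p hp
      rcases List.mem_append.1 hp with hp | hp
      exacts [h₃ p hp, k₃ p hp]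
  · refine ⟨j, L ++ M, ⟨List.mem_append_right _ k₁, ?_, ?_⟩, ofWord_append L M⟩
    · rw [List.mem_append, not_or]
      exact ⟨fun hm => absurd (h₃ _ hm) (not_le.2 h), k₂⟩
    · intro p hp
      rcases List.mem_append.1 hp with hp | hp
      exacts [h.le.trans (h₃ p hp), k₃ p hp]

/-- The braids `β ≽ 1`. -/
def nonneg (n : ℕ) : Submonoid (Braid n) where
  carrier := {β | β = 1 ∨ DehornoyPos β}
  one_mem' := Or.inl rfl
  mul_mem' := by
    rintro a b (rfl | ha) (rfl | hb)
    · exact Or.inl (one_mul 1)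
    · exact Or.inr ((one_mul b).symm ▸ hb)
    · exact Or.inr ((mul_one a).symm ▸ ha)
    · exact Or.inr (ha.mul hb)

theorem dehornoyLE_iff {n : ℕ} {α β : Braid n} : DehornoyLE α β ↔ α⁻¹ * β ∈ nonneg n := by
  change _ ∨ _ ↔ _ = 1 ∨ _
  rw [inv_mul_eq_one]
  rfl

theorem DehornoyPos.inv_notMem_nonneg {n : ℕ} {β : Braid n} (h : DehornoyPos β) :
    β⁻¹ ∉ nonneg n := by
  rintro (h' | h')
  · rw [inv_eq_one] at h'
    exact not_dehornoyPos_one (h' ▸ h)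
  · have := h.mul h'
    rw [mul_inv_cancel] at this
    exact not_dehornoyPos_one this

end Braid
namespace Braid

/-! ### Words, and the full twist as a central cofinal element. -/

theorem ofWord_surjective {n : ℕ} (β : Braid n) : ∃ L, ofWord L = β := by
  have hβ : β ∈ Subgroup.closure (Set.range (σ : Fin (n - 1) → Braid n)) := by
    have : Subgroup.closure (Set.range (σ : Fin (n - 1) → Braid n)) = ⊤ :=
      PresentedGroup.closure_range_of _
    rw [this]
    trivial
  induction hβ using Subgroup.closure_induction_left with
  | one => exact ⟨[], rfl⟩
  | mul_left x hx y _ ih =>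
    obtain ⟨i, rfl⟩ := hx
    obtain ⟨L, rfl⟩ := ih
    exact ⟨(i, true) :: L, ofWord_cons _ _⟩
  | inv_mul_cancel x hx y _ ih =>
    obtain ⟨i, rfl⟩ := hx
    obtain ⟨L, rfl⟩ := ih
    exact ⟨(i, false) :: L, ofWord_cons _ _⟩

/-- A semiconjugation of generators extends to words. -/
theorem semiconjBy_ofWord {m n : ℕ} (φ : Braid m →* Braid n) (g : Braid n)
    (f : Fin (m - 1) → Fin (n - 1)) (h : ∀ i, SemiconjBy g (φ (σ i)) (σ (f i)))
    (L : List (Fin (m - 1) × Bool)) :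
    SemiconjBy g (φ (ofWord L)) (ofWord (L.map fun p => (f p.1, p.2))) := by
  induction L with
  | nil => simp [ofWord]
  | cons p L ih =>
    obtain ⟨i, e⟩ := p
    rw [List.map_cons, ofWord_cons, ofWord_cons, map_mul]
    refine SemiconjBy.mul_right ?_ ih
    cases e
    · simpa using (h i).inv_right
    · simpa using h i

theorem incl_σ {n : ℕ} (i : Fin (n - 1)) :
    incl n (σ i) = σ (Fin.castLE (Nat.sub_le_sub_right n.le_succ 1) i) :=
  PresentedGroup.toGroup.of _

theorem incl_ofWord {n : ℕ} (L : List (Fin (n - 1) × Bool)) :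
    incl n (ofWord L) =
      ofWord (L.map fun p => (Fin.castLE (Nat.sub_le_sub_right n.le_succ 1) p.1, p.2)) := by
  have := semiconjBy_ofWord (incl n) 1 _ (fun i => by rw [incl_σ]; exact SemiconjBy.one_left _) L
  simpa [SemiconjBy] using this

/-- The Garside braid has a positive word in which all generators occur. -/
theorem exists_garside_word (n : ℕ) :
    ∃ L : List (Fin (n - 1) × Bool),
      (∀ p ∈ L, p.2 = true) ∧ (∀ i, (i, true) ∈ L) ∧ ofWord L = garside n := by
  induction n with
  | zero => exact ⟨[], by simp, fun i => i.elim0, rfl⟩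
  | succ n ih =>
    obtain ⟨L, hpos, -, hL⟩ := ih
    refine ⟨((List.finRange n).map (fun i => (i, true)) : List (Fin (n + 1 - 1) × Bool)) ++
      L.map fun p => (Fin.castLE (Nat.sub_le_sub_right n.le_succ 1) p.1, p.2), ?_, ?_, ?_⟩
    · intro p hp
      rcases List.mem_append.1 hp with hp | hp
      · obtain ⟨i, -, rfl⟩ := List.mem_map.1 hp
        rfl
      · obtain ⟨q, hq, rfl⟩ := List.mem_map.1 hp
        exact hpos q hq
    · intro i
      exact List.mem_append_left _ (List.mem_map.2 ⟨i, List.mem_finRange i, rfl⟩)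
    · rw [ofWord_append, ← incl_ofWord, hL, garside]
      congr 1
      simp [ofWord, Function.comp_def]

/-- The Artin generators as a sequence, continued by `1`. -/
def σSeq (n : ℕ) (k : ℕ) : Braid n := if h : k < n - 1 then σ ⟨k, h⟩ else 1

theorem σSeq_val {n : ℕ} (i : Fin (n - 1)) : σSeq n i = σ i := by
  simp [σSeq]

/-- Continuation by `1` preserves far commutativity but not the braid relation at the end, hence the
bound `n - 1` on the latter alone. -/
theorem isBraidSeq_σSeq (n : ℕ) : IsBraidSeq (σSeq n) (n - 1) where
  comm {i j} h := by
    unfold σSeq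
    split_ifs
    · exact σ_comm h
    all_goals simp
  braid {i} h := by
    rw [σSeq, σSeq, dif_pos (by omega), dif_pos h]
    exact σ_braid rfl

/-- The homomorphism is arbitrary so that the induction can replace `φ` by `φ.comp (incl n)`. -/
theorem map_garside {G : Type*} [Group G] (s : ℕ → G) (n : ℕ) (φ : Braid n →* G)
    (h : ∀ i : Fin (n - 1), φ (σ i) = s i) : φ (garside n) = IsBraidSeq.delta s n := by
  induction n with
  | zero => exact map_one φ
  | succ n ih =>
    have h' : (φ.comp (incl n)) (garside n) = IsBraidSeq.delta s n :=
      ih _ fun i => by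
        rw [MonoidHom.comp_apply, incl_σ, h]
        rfl
    rw [garside, map_mul, map_list_prod, List.map_map, IsBraidSeq.delta, IsBraidSeq.asc_eq_prod,
      ← h', ← List.map_coe_finRange_eq_range, List.map_map]
    congr 2
    exact List.map_congr_left fun i _ => h i

theorem garside_eq_delta (n : ℕ) : garside n = IsBraidSeq.delta (σSeq n) n :=
  map_garside (σSeq n) n (MonoidHom.id _) fun i => (σSeq_val i).symm

theorem garside_semiconj {n : ℕ} (i : Fin (n + 1)) :
    SemiconjBy (garside (n + 2)) (σ i) (σ i.rev) := by
  have := (isBraidSeq_σSeq (n + 2)).delta_mul (n := n + 1) i.2 le_rfl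
  rw [← garside_eq_delta] at this
  have hr : n + 1 - 1 - (i : ℕ) = i.rev := by
    rw [Fin.val_rev]
    omega
  rw [hr] at this
  rw [← σSeq_val (n := n + 2) i, ← σSeq_val (n := n + 2) i.rev]
  exact this

theorem garside_sq_comm {n : ℕ} (g : Braid (n + 2)) : Commute (garside (n + 2) ^ 2) g := by
  obtain ⟨L, rfl⟩ := ofWord_surjective g
  have := semiconjBy_ofWord (MonoidHom.id _) (garside (n + 2) ^ 2) id (fun i => by
    have h₁ := garside_semiconj (n := n) i
    have h₂ := (garside_semiconj (n := n) i.rev).mul_left h₁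
    rw [Fin.rev_rev, ← sq] at h₂
    exact h₂) L
  simpa [Commute] using this

theorem ofWord_mem_nonneg {n : ℕ} (L : List (Fin (n - 1) × Bool)) (h : ∀ p ∈ L, p.2 = true) :
    ofWord L ∈ nonneg n := by
  induction L with
  | nil => exact Or.inl rfl
  | cons p L ih =>
    rw [ofWord_cons]
    refine mul_mem (Or.inr ⟨p.1, [p], ⟨?_, ?_, ?_⟩, ?_⟩)
      (ih fun q hq => h q (List.mem_cons_of_mem _ hq))
    · rw [← h p List.mem_cons_self]
      exact List.mem_singleton_self _
    · rw [List.mem_singleton]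
      intro e
      have := h p List.mem_cons_self
      rw [← e] at this
      cases this
    · intro q hq
      rw [List.mem_singleton.1 hq]
    · simp [ofWord]

/-- Cancelling any generator in the full twist leaves a positive word, in which all generators
occur. -/
theorem exists_garside_sq_mul_inv_word {n : ℕ} (i : Fin (n + 1)) :
    ∃ L : List (Fin (n + 2 - 1) × Bool), (∀ p ∈ L, p.2 = true) ∧ (∀ j, (j, true) ∈ L) ∧
      ofWord L = garside (n + 2) ^ 2 * (σ i)⁻¹ := by
  obtain ⟨L, hpos, hall, hL⟩ := exists_garside_word (n + 2)
  obtain ⟨A, B, hAB⟩ := List.append_of_mem (hall i)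
  -- With `Δ = A σᵢ B`, one has `B Δ A σᵢ = B Δ² B⁻¹ = Δ²` by centrality. The intact copy of `L` in
  -- the middle keeps every generator present.
  refine ⟨B ++ L ++ A, ?_, ?_, ?_⟩
  · intro p hp
    have : p ∈ L := by
      rw [List.mem_append, List.mem_append] at hp
      rcases hp with (hp | hp) | hp
      · rw [hAB]
        exact List.mem_append_right _ (List.mem_cons_of_mem _ hp)
      · exact hp
      · rw [hAB]
        exact List.mem_append_left _ hp
    exact hpos p this
  · exact fun j => List.mem_append_left _ (List.mem_append_right _ (hall j))
  · have hg : garside (n + 2) = ofWord A * (σ i * ofWord B) := by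
      rw [← hL, hAB, ofWord_append, ofWord_cons]
      rfl
    rw [eq_mul_inv_iff_mul_eq, ofWord_append, ofWord_append, hL]
    calc _ = ofWord B * (garside (n + 2) * (ofWord A * (σ i * ofWord B))) * (ofWord B)⁻¹ := by
          group
      _ = _ := by
        rw [← hg, ← sq, ← (garside_sq_comm (ofWord B)).eq, mul_inv_cancel_right]

theorem garside_sq_mem_nonneg (n : ℕ) : garside n ^ 2 ∈ nonneg n := by
  obtain ⟨L, hpos, -, hL⟩ := exists_garside_word n
  rw [← hL]
  exact pow_mem (ofWord_mem_nonneg L hpos) 2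

/-- Each inverse letter is absorbed by one full twist, which is central and can be moved next to it.
-/
theorem exists_garside_pow_mul_mem {n : ℕ} (g : Braid (n + 2)) :
    ∃ c : ℕ, (garside (n + 2) ^ 2) ^ c * g ∈ nonneg (n + 2) := by
  obtain ⟨L, rfl⟩ := ofWord_surjective g
  induction L with
  | nil => exact ⟨0, Or.inl (by simp [ofWord])⟩
  | cons p L ih =>
    obtain ⟨c, hc⟩ := ih
    obtain ⟨i, e⟩ := p
    have hcomm := ((garside_sq_comm (n := n) (σ i)⁻¹).pow_left c).eq
    cases e
    · refine ⟨c + 1, ?_⟩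
      obtain ⟨K, hK, -, hKe⟩ := exists_garside_sq_mul_inv_word i
      have := mul_mem (ofWord_mem_nonneg K hK) hc
      rw [hKe] at this
      rw [ofWord_cons, pow_succ']
      simp only [Bool.false_eq_true, if_false]
      rwa [mul_assoc, ← mul_assoc _ (σ i)⁻¹, hcomm, mul_assoc, ← mul_assoc]
    · refine ⟨c, ?_⟩
      have hi := ofWord_mem_nonneg (n := n + 2) [(i, true)] (by simp)
      have := mul_mem hi hc
      have e : ofWord (n := n + 2) [(i, true)] = σ i := by simp [ofWord]
      rw [e] at this
      rw [ofWord_cons]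
      simp only [if_true]
      rwa [← mul_assoc, ((garside_sq_comm (n := n) (σ i)).pow_left c).eq, mul_assoc]

theorem dehornoyPos_garside_sq (n : ℕ) : DehornoyPos (garside (n + 2) ^ 2) := by
  obtain ⟨L, hpos, hall, hL⟩ := exists_garside_word (n + 2)
  have : DehornoyPos (garside (n + 2)) :=
    ⟨(0 : Fin (n + 1)), L, ⟨hall _, fun h => by (cases hpos _ h),
      fun _ _ => Nat.zero_le _⟩, hL⟩
  rw [sq]
  exact this.mul this

theorem centralCone (n : ℕ) : CentralCone (nonneg (n + 2)) (garside (n + 2) ^ 2) where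
  comm := garside_sq_comm
  cofinal g := by
    obtain ⟨c, hc⟩ := exists_garside_pow_mul_mem g
    exact ⟨c, by rwa [zpow_natCast]⟩
  nonneg_of_mem l hl := by
    by_contra! hneg
    -- Multiplying by `k` further full twists reduces every negative exponent to `-1`, which
    -- acyclicity excludes.
    obtain ⟨k, rfl⟩ : ∃ k : ℕ, l = -((k : ℤ) + 1) := ⟨(-l - 1).toNat, by omega⟩
    have := mul_mem hl (pow_mem (garside_sq_mem_nonneg (n + 2)) k)
    rw [← zpow_natCast (garside (n + 2) ^ 2) k, ← zpow_add,
      show -((k : ℤ) + 1) + k = -1 by ring, zpow_neg_one] at this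
    exact (dehornoyPos_garside_sq n).inv_notMem_nonneg this

/-! ### Existence of the twist coefficient and its bounds. -/

theorem isDehornoyFloor_iff {n : ℕ} {β : Braid n} {m : ℤ} :
    IsDehornoyFloor β m ↔ CentralCone.IsFloor (nonneg n) (garside n ^ 2) β m := by
  have : {l : ℤ | DehornoyLE (garside n ^ (2 * l)) β} =
      {l : ℤ | (garside n ^ 2) ^ (-l) * β ∈ nonneg n} := by
    ext l
    rw [Set.mem_ofPred_eq, Set.mem_ofPred_eq, dehornoyLE_iff, zpow_neg, zpow_mul]
    rfl
  rw [IsDehornoyFloor, this, CentralCone.IsFloor]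

/-- The fractional Dehn twist coefficient exists. -/
theorem isBT_BT {n : ℕ} (β : Braid (n + 2)) : IsBT β (BT β) := by
  have h : ∃ r, IsBT β r := by
    choose f hf using fun k : ℕ => (centralCone n).exists_isFloor (β ^ k)
    obtain ⟨r, hr⟩ := (centralCone n).exists_tendsto β f hf
    exact ⟨r, f, fun k => isDehornoyFloor_iff.2 (hf k), hr⟩
  rw [BT, dif_pos h]
  exact h.choose_spec

theorem neg_le_BT {n : ℕ} {γ β : Braid (n + 2)} {a : ℤ}
    (hγ : (garside (n + 2) ^ 2) ^ a * γ ∈ nonneg (n + 2)) (hc : IsConj γ β) :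
    -(a : ℝ) ≤ BT β := by
  obtain ⟨f, hf, hr⟩ := isBT_BT β
  exact (centralCone n).neg_le_of_isConj hγ hc (fun k => isDehornoyFloor_iff.1 (hf k)) hr

theorem BT_le {n : ℕ} {γ β : Braid (n + 2)} {a : ℤ}
    (hγ : (garside (n + 2) ^ 2) ^ a * γ⁻¹ ∈ nonneg (n + 2)) (hc : IsConj γ β) :
    BT β ≤ a := by
  obtain ⟨f, hf, hr⟩ := isBT_BT β
  exact (centralCone n).le_of_isConj hγ hc (fun k => isDehornoyFloor_iff.1 (hf k)) hr

/-! ### Stabilizations after reversal of the strands. -/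

/-- A braid with a word that contains `σ₁` but not `σ₁⁻¹` is positive. -/
theorem mem_nonneg_of_word {n : ℕ} {L : List (Fin (n + 2 - 1) × Bool)}
    (h₁ : ((0 : Fin (n + 1)), true) ∈ L) (h₂ : ((0 : Fin (n + 1)), false) ∉ L) :
    ofWord L ∈ nonneg (n + 2) :=
  Or.inr ⟨(0 : Fin (n + 1)), L, ⟨h₁, h₂, fun _ _ => Nat.zero_le _⟩, rfl⟩

/-- The braids with a word in the generators other than `σ₁`. -/
def IsShifted {n : ℕ} (ξ : Braid (n + 2)) : Prop :=
  ∃ L : List (Fin (n + 2 - 1) × Bool), (∀ p ∈ L, (p.1 : ℕ) ≠ 0) ∧ ofWord L = ξ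

theorem IsShifted.inv {n : ℕ} {ξ : Braid (n + 2)} (h : IsShifted ξ) : IsShifted ξ⁻¹ := by
  obtain ⟨L, hL, rfl⟩ := h
  refine ⟨(L.map fun p => (p.1, !p.2)).reverse, fun p hp => ?_, ?_⟩
  · obtain ⟨q, hq, rfl⟩ := List.mem_map.1 (List.mem_reverse.1 hp)
    exact hL q hq
  · clear hL
    induction L with
    | nil => simp [ofWord]
    | cons p L ih =>
      rw [List.map_cons, List.reverse_cons, ofWord_append, ih, ofWord_cons p, mul_inv_rev]
      congr 1
      obtain ⟨i, e⟩ := p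
      cases e <;> simp [ofWord]

/-- The image of `incl` avoids the last generator, and reversal by the Garside element makes the
last generator the first. -/
theorem isShifted_conj_incl {n : ℕ} (α : Braid (n + 1)) :
    ∃ ξ : Braid (n + 2), IsShifted ξ ∧ SemiconjBy (garside (n + 2)) (incl (n + 1) α) ξ := by
  obtain ⟨L, rfl⟩ := ofWord_surjective α
  refine ⟨_, ⟨L.map fun p => ((Fin.castSucc p.1).rev, p.2), fun p hp => ?_, rfl⟩,
    semiconjBy_ofWord (incl (n + 1)) _ (fun i : Fin n => (Fin.castSucc i).rev) (fun i => ?_) L⟩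
  · obtain ⟨⟨q, e⟩, hq, rfl⟩ := List.mem_map.1 hp
    have := q.2
    intro h
    simp only [Fin.val_rev, Fin.val_castSucc] at h
    omega
  · rw [incl_σ]
    exact garside_semiconj (n := n) (Fin.castSucc i)

theorem IsShifted.mul_σ_mem {n : ℕ} {ξ : Braid (n + 2)} (h : IsShifted ξ) :
    ξ * σ (0 : Fin (n + 1)) ∈ nonneg (n + 2) := by
  obtain ⟨L, hL, rfl⟩ := h
  have : ofWord (L ++ ([((0 : Fin (n + 1)), true)] : List (Fin (n + 2 - 1) × Bool))) =
      ofWord L * σ (0 : Fin (n + 1)) := by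
    rw [ofWord_append]
    simp [ofWord]
  rw [← this]
  refine mem_nonneg_of_word (by simp) fun hm => ?_
  rcases List.mem_append.1 hm with hm | hm
  · exact hL _ hm rfl
  · simp at hm

theorem IsShifted.σ_mul_mem {n : ℕ} {ξ : Braid (n + 2)} (h : IsShifted ξ) :
    σ (0 : Fin (n + 1)) * ξ ∈ nonneg (n + 2) := by
  obtain ⟨L, hL, rfl⟩ := h
  have : ofWord (((0 : Fin (n + 1)), true) :: L) = σ (0 : Fin (n + 1)) * ofWord L := by
    rw [ofWord_cons]
    simp
  rw [← this]
  refine mem_nonneg_of_word (by simp) fun hm => ?_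
  rcases List.mem_cons.1 hm with hm | hm
  · simp at hm
  · exact hL _ hm rfl

/-- The full twist absorbs `σ₁⁻¹` and still leaves a positive word containing `σ₁`; appending `ξ`
adds no `σ₁⁻¹`. -/
theorem IsShifted.garside_sq_mul_mem {n : ℕ} {ξ : Braid (n + 2)} (h : IsShifted ξ) :
    garside (n + 2) ^ 2 * ((σ (0 : Fin (n + 1)))⁻¹ * ξ) ∈ nonneg (n + 2) := by
  obtain ⟨L, hL, rfl⟩ := h
  obtain ⟨K, hpos, hall, hK⟩ := exists_garside_sq_mul_inv_word (0 : Fin (n + 1))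
  rw [← mul_assoc, ← hK, ← ofWord_append]
  refine mem_nonneg_of_word (List.mem_append_left _ (hall _)) fun hm => ?_
  rcases List.mem_append.1 hm with hm | hm
  · cases hpos _ hm
  · exact hL _ hm rfl

theorem isConj_of_semiconjBy {G : Type*} [Group G] {g a b c : G} (h : SemiconjBy g a b)
    (hc : IsConj a c) : IsConj b c :=
  (isConj_iff.2 ⟨g, by rw [h.eq, mul_inv_cancel_right]⟩ : IsConj a b).symm.trans hc

theorem garside_semiconj_last (n : ℕ) :
    SemiconjBy (garside (n + 2)) (σ (Fin.last n)) (σ (0 : Fin (n + 1))) := by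
  have := garside_semiconj (Fin.last n)
  rwa [Fin.rev_last] at this

end Braid

theorem proposition4p11 (n : ℕ) (β : Braid (n + 2)) :
    (Braid.AdmitsPosDestab β →
      Braid.IsBT β (Braid.BT β) ∧ 0 ≤ Braid.BT β ∧ Braid.BT β ≤ 1) ∧
    (Braid.AdmitsNegDestab β →
      Braid.IsBT β (Braid.BT β) ∧ -1 ≤ Braid.BT β ∧ Braid.BT β ≤ 0) := by
  constructor
  · rintro ⟨α, hα⟩
    obtain ⟨ξ, hξ, hs⟩ := Braid.isShifted_conj_incl α
    have hc := Braid.isConj_of_semiconjBy (hs.mul_right (Braid.garside_semiconj_last n)) hα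
    refine ⟨Braid.isBT_BT β, ?_, ?_⟩
    · simpa using Braid.neg_le_BT (a := 0) (by simpa using hξ.mul_σ_mem) hc
    -- Here `(ξ σ₁)⁻¹ = σ₁⁻¹ ξ⁻¹`, and `ξ⁻¹` is again free of `σ₁^{±1}`.
    · simpa using Braid.BT_le (a := 1) (by simpa using hξ.inv.garside_sq_mul_mem) hc
  · rintro ⟨α, hα⟩
    obtain ⟨ξ, hξ, hs⟩ := Braid.isShifted_conj_incl α
    have hc := Braid.isConj_of_semiconjBy
      (hs.mul_right (Braid.garside_semiconj_last n).inv_right) hα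
    refine ⟨Braid.isBT_BT β, ?_, ?_⟩
    -- The cyclic shift of `ξ σ₁⁻¹` to `σ₁⁻¹ ξ` puts `σ₁⁻¹` next to the full twist that absorbs it.
    · have hc' : IsConj ((Braid.σ (0 : Fin (n + 1)))⁻¹ * ξ) β :=
        (isConj_iff.2 ⟨ξ, by group⟩ :
          IsConj ((Braid.σ (0 : Fin (n + 1)))⁻¹ * ξ) (ξ * (Braid.σ (0 : Fin (n + 1)))⁻¹)).trans hc
      simpa using Braid.neg_le_BT (a := 1) (by simpa using hξ.garside_sq_mul_mem) hc'
    · simpa using Braid.BT_le (a := 0) (by simpa using hξ.inv.σ_mul_mem) hc
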